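/- Let $\mathcal H$ be an infinite-dimensional separable Hilbert space over $\mathbb R$ or $\mathbb C$. Say that $A+\delta I$ is a positive definite unitized Hilbert–Schmidt operator if $A=A^*$ is a Hilbert–Schmidt operator on $\mathcal H$, $\delta\ge 0$, and there is $C>0$ with $\langle x,(A+\delta I)x\rangle\ge C\|x\|^2$ for all $x\in\mathcal H$. Real powers of such an operator are defined by applying the power to its eigenvalues on its eigenspaces. Let $\alpha>0$, $\delta,\gamma\ge 0$, $\rho>0$, and let $X+\delta I$, $Y+\gamma I$ and $M+\rho I$ be positive definite unitized Hilbert–Schmidt operators. For an operator $U$ such that $I+U$ is unitary (orthogonal in the real case) put $$D(U)=\frac{(X+\delta I)^{\alpha}-(Y+\gamma I)^{\alpha}(I+U)}{\alpha}.$$ The extended Mahalanobis norm of a bounded operator $Z$ is $$\|Z\|_{M_\infty^{-1}}=\sqrt{\operatorname{tr}\bigl(Z^*(M+\rho I)^{-1}Z\bigr)}\in[0,\infty],$$ where $\operatorname{tr}$ is the ordinary trace of a positive operator. Since this trace is infinite on operators with a non-zero scalar part, we also consider the unitized version $$\|Z\|_{M_\infty^{-1},\mathrm{ext}}=\bigl\|(M+\rho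 I)^{-1/2}Z\bigr\|_{\mathrm{eHS}},\qquad \|K+cI\|_{\mathrm{eHS}}^2=\|K\|_{\mathrm{HS}}^2+|c|^2\quad(K\text{ Hilbert–Schmidt},\ c\text{ scalar}),$$ with value $\infty$ if $(M+\rho I)^{-1/2}Z$ is not of the form $K+cI$. Then the infima that define the generalised $\alpha$-Procrustes distance between $X+\delta I$ and $Y+\gamma I$ are minima: 1. The infimum $d$ of $\|D(U)\|_{M_\infty^{-1}}$ over all $U$ with $I+U$ unitary is attained, so $$d=\min_{I+U\in\mathbb U(\mathcal H)}\left\|\frac{(X+\delta I)^{\alpha}-(Y+\gamma I)^{\alpha}(I+U)}{\alpha}\right\|_{M_\infty^{-1}}\in[0,\infty].$$ 2. The infimum $d_{\mathrm{ext}}$ of $\|D(U)\|_{M_\infty^{-1},\mathrm{ext}}$ over all Hilbert–Schmidt $U$ with $I+U$ unitary is finite and attained, so $$d_{\mathrm{ext}}=\min_{I+U\in\mathbb U(\mathcal H),\ U\ \text{Hilbert–Schmidt}}\left\|\frac{(X+\delta I)^{\alpha}-(Y+\gamma I)^{\alpha}(I+U)}{\alpha}\right\|_{M_\infty^{-1},\mathrm{ext}}\in[0,\infty).$$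 3. If $\delta=\gamma$, then $d=d_{\mathrm{ext}}$. -/

import Mathlib

namespace AlphaProcrustes

open scoped ENNReal

noncomputable section

variable {𝕜 : Type*} [RCLike 𝕜] {H : Type*} [NormedAddCommGroup H] [InnerProductSpace 𝕜 H]
  [CompleteSpace H]

variable (𝕜 H) in
/-- The index set of a fixed orthonormal (Hilbert) basis of `H`. -/
def basisIndex : Set H := (exists_hilbertBasis 𝕜 H).choose

variable (𝕜 H) in
/-- A fixed orthonormal (Hilbert) basis of `H`. -/
def basis : HilbertBasis (basisIndex 𝕜 H) 𝕜 H := (exists_hilbertBasis 𝕜 H).choose_spec.choose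

/-- The trace `∑ i, ⟨e i, T (e i)⟩ ∈ [0, ∞]` of a positive operator `T`, for an orthonormal
basis `e`. It is only ever applied to operators of the form `Z* P Z` with `P ≥ 0`, for which the
terms are nonnegative and the sum does not depend on the basis. -/
def trace (T : H →L[𝕜] H) : ℝ≥0∞ :=
  ∑' i : basisIndex 𝕜 H,
    ENNReal.ofReal (RCLike.re (inner 𝕜 (basis 𝕜 H i) (T (basis 𝕜 H i))))

/-- `A` is a Hilbert–Schmidt operator: `A* A` is of trace class. -/
def IsHilbertSchmidt (A : H →L[𝕜] H) : Prop := trace (star A * A) < ∞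

/-- The operator `A + δ I`. -/
def shift (A : H →L[𝕜] H) (δ : ℝ) : H →L[𝕜] H := A + (δ : 𝕜) • (1 : H →L[𝕜] H)

/-- Positive definite operators: self-adjoint and bounded below by a positive constant. -/
def IsPosDef (T : H →L[𝕜] H) : Prop :=
  IsSelfAdjoint T ∧ ∃ C : ℝ, 0 < C ∧ ∀ x : H, C * ‖x‖ ^ 2 ≤ RCLike.re (inner 𝕜 x (T x))

/-- `A + δ I` is a positive definite unitized Hilbert–Schmidt operator: `A` is a self-adjoint
Hilbert–Schmidt operator, `δ ≥ 0`, and `A + δ I` is positive definite. -/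
structure IsUnitizedHSPosDef (A : H →L[𝕜] H) (δ : ℝ) : Prop where
  isSelfAdjoint : IsSelfAdjoint A
  isHilbertSchmidt : IsHilbertSchmidt A
  nonneg : 0 ≤ δ
  isPosDef : IsPosDef (shift A δ)

/-- `S` acts as multiplication by `t ^ s` on each eigenspace `ker (T - t I)`, `t` real. -/
def IsPower (T : H →L[𝕜] H) (s : ℝ) (S : H →L[𝕜] H) : Prop :=
  ∀ (t : ℝ) (x : H), T x = (t : 𝕜) • x → S x = ((t ^ s : ℝ) : 𝕜) • x

open Classical in
/-- The real power `T ^ s` of a positive definite unitized Hilbert–Schmidt operator `T`: the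
bounded operator that acts as `t ^ s` on each eigenspace `ker (T - t I)`. For such `T` the
eigenvectors span a dense subspace (spectral theorem for the compact part), and the eigenvalues
lie in a compact subset of `(0, ∞)`, so this operator exists and is unique. -/
def power (T : H →L[𝕜] H) (s : ℝ) : H →L[𝕜] H :=
  if h : ∃ S : H →L[𝕜] H, IsPower T s S then h.choose else 0

/-- The extended Mahalanobis norm `√ tr (Z* (M + ρ I)⁻¹ Z) ∈ [0, ∞]`, with the ordinary trace. -/
def mahalanobisNorm (M : H →L[𝕜] H) (ρ : ℝ) (Z : H →L[𝕜] H) : ℝ≥0∞ :=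
  trace (star Z * Ring.inverse (shift M ρ) * Z) ^ (1 / 2 : ℝ)

/-- The extended Hilbert–Schmidt norm: `‖K + c I‖² = ‖K‖_HS² + |c|²` for `K` Hilbert–Schmidt, and
`∞` for operators that are not of this form. If `H` is infinite-dimensional, at most one scalar
`c` gives a finite term, and it gives the value of the infimum. -/
def extendedHSNorm (Z : H →L[𝕜] H) : ℝ≥0∞ :=
  ⨅ c : 𝕜, (trace (star (Z - c • (1 : H →L[𝕜] H)) * (Z - c • (1 : H →L[𝕜] H)))
    + ENNReal.ofReal (‖c‖ ^ 2)) ^ (1 / 2 : ℝ)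

/-- The extended Mahalanobis norm in which the Hilbert–Schmidt norm is replaced by the extended
Hilbert–Schmidt norm: `‖(M + ρ I)^(-1/2) Z‖_eHS`. -/
def unitizedMahalanobisNorm (M : H →L[𝕜] H) (ρ : ℝ) (Z : H →L[𝕜] H) : ℝ≥0∞ :=
  extendedHSNorm (power (shift M ρ) (-1 / 2) * Z)

/-- The operator `((X + δ I)^α - (Y + γ I)^α (I + U)) / α`. -/
def residual (α : ℝ) (X : H →L[𝕜] H) (δ : ℝ) (Y : H →L[𝕜] H) (γ : ℝ) (U : H →L[𝕜] H) :
    H →L[𝕜] H :=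
  ((α⁻¹ : ℝ) : 𝕜) • (power (shift X δ) α - power (shift Y γ) α * (1 + U))

variable (𝕜 H) in
/-- The operators `U` such that `I + U` is unitary. -/
def unitaryShifts : Set (H →L[𝕜] H) := {U | 1 + U ∈ unitary (H →L[𝕜] H)}

variable (𝕜 H) in
/-- The Hilbert–Schmidt operators `U` such that `I + U` is unitary. -/
def unitaryHSShifts : Set (H →L[𝕜] H) := {U | 1 + U ∈ unitary (H →L[𝕜] H) ∧ IsHilbertSchmidt U}

/-- The generalized alpha-Procrustes distance, as an infimum over all unitaries `I + U`, in the
extended Mahalanobis norm with the ordinary trace. -/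
def procrustesDist (M : H →L[𝕜] H) (ρ α : ℝ) (X : H →L[𝕜] H) (δ : ℝ) (Y : H →L[𝕜] H) (γ : ℝ) :
    ℝ≥0∞ :=
  ⨅ U ∈ unitaryShifts 𝕜 H, mahalanobisNorm M ρ (residual α X δ Y γ U)

/-- The generalized alpha-Procrustes distance, as an infimum over the unitaries `I + U` of the
unitized Hilbert–Schmidt algebra, in the unitized extended Mahalanobis norm. -/
def unitizedProcrustesDist (M : H →L[𝕜] H) (ρ α : ℝ) (X : H →L[𝕜] H) (δ : ℝ) (Y : H →L[𝕜] H)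
    (γ : ℝ) : ℝ≥0∞ :=
  ⨅ U ∈ unitaryHSShifts 𝕜 H, unitizedMahalanobisNorm M ρ (residual α X δ Y γ U)

end

end AlphaProcrustes

/-! Write `R = (M + ρ)^(-1/2)`, `A = (X + δ)^α`, `B = (Y + γ)^α`, `W = 1 + U`. Each of `R`, `A`, `B`
is a positive scalar (`r`, `a`, `b`) plus a Hilbert–Schmidt operator. In infinite dimension the
scalar part is unique, so for Hilbert–Schmidt `U` the scalar part of `R (A - B W)` is `c = r (a -
b)` whatever `U` is. It remains to minimise the Hilbert–Schmidt norm of `C - G W`, where `C = R A -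
c` and `G = R B` both have scalar part `r b`.

As in the matrix Procrustes problem, `W` is optimal once `C* G W ≥ 0` (`hsSq_sub_le_of_nonneg`).
Such a `W` comes from a polar decomposition of `N = C* G` (`exists_unitary_mul_nonneg`). `N` may
have a kernel, so the partial isometry is completed to a unitary using an isometry `ker N* ≃ ker N`
(`nonempty_ker_star_isometry`); the scalar part `(r b)^2 > 0` makes these kernels finite-dimensional
and `W - 1` Hilbert–Schmidt.

For the ordinary trace, a finite value forces `δ = γ` and `U` Hilbert–Schmidt, and then the two
norms coincide. Hence one `U` minimises both, trivially so for the ordinary trace when `δ ≠ γ`,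
where every value is infinite. -/

namespace AlphaProcrustes

open scoped ENNReal

noncomputable section

variable {𝕜 : Type*} [RCLike 𝕜] {H : Type*} [NormedAddCommGroup H] [InnerProductSpace 𝕜 H]
  [CompleteSpace H]

/-! ### Hilbert–Schmidt operators: basis independence and ideal properties. -/

/-- The square of the Hilbert–Schmidt norm. -/
def hsSq (A : H →L[𝕜] H) : ℝ≥0∞ := ∑' i, ‖A (basis 𝕜 H i)‖ₑ ^ 2

theorem hasSum_norm_inner_sq {E : Type*} [NormedAddCommGroup E] [InnerProductSpace 𝕜 E]
    {ι : Type*} (b : HilbertBasis ι 𝕜 E) (x : E) :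
    HasSum (fun i => ‖inner 𝕜 (b i) x‖ ^ 2) (‖x‖ ^ 2) := by
  have h := (b.hasSum_inner_mul_inner x x).mapL RCLike.reCLM
  rw [RCLike.reCLM_apply, inner_self_eq_norm_sq] at h
  have h2 : (fun i => ‖inner 𝕜 (b i) x‖ ^ 2) =
      fun i => RCLike.reCLM (inner 𝕜 x (b i) * inner 𝕜 (b i) x) := by
    ext i
    rw [RCLike.reCLM_apply, ← inner_conj_symm x (b i), RCLike.conj_mul]
    norm_cast
  rw [h2]
  exact h

theorem tsum_enorm_inner_sq {E : Type*} [NormedAddCommGroup E] [InnerProductSpace 𝕜 E]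
    {ι : Type*} (b : HilbertBasis ι 𝕜 E) (x : E) :
    ∑' i, ‖inner 𝕜 (b i) x‖ₑ ^ 2 = ‖x‖ₑ ^ 2 := by
  have h := hasSum_norm_inner_sq b x
  have h2 := ENNReal.ofReal_tsum_of_nonneg (fun i => sq_nonneg _) h.summable
  rw [h.tsum_eq] at h2
  simpa [ENNReal.ofReal_pow] using h2.symm

/-- Parseval turns both sides into the same double sum of squared matrix entries. As `b` is
arbitrary, this yields invariance under the adjoint as well as independence of the basis. -/
theorem hsSq_eq_tsum_star {ι : Type*} (b : HilbertBasis ι 𝕜 H) (A : H →L[𝕜] H) :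
    hsSq A = ∑' i, ‖(star A) (b i)‖ₑ ^ 2 := by
  unfold hsSq
  simp_rw [← tsum_enorm_inner_sq b (A _), ← tsum_enorm_inner_sq (basis 𝕜 H) (star A _)]
  rw [ENNReal.tsum_comm]
  refine tsum_congr fun j => tsum_congr fun i => ?_
  rw [ContinuousLinearMap.star_eq_adjoint, ContinuousLinearMap.adjoint_inner_right,
    ← inner_conj_symm, ← ofReal_norm, ← ofReal_norm, RCLike.norm_conj]

theorem hsSq_star (A : H →L[𝕜] H) : hsSq (star A) = hsSq A := (hsSq_eq_tsum_star _ A).symm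

theorem hsSq_eq_tsum {ι : Type*} (b : HilbertBasis ι 𝕜 H) (A : H →L[𝕜] H) :
    hsSq A = ∑' i, ‖A (b i)‖ₑ ^ 2 := by
  rw [← hsSq_star, hsSq_eq_tsum_star b, star_star]

theorem trace_star_mul_self (A : H →L[𝕜] H) : trace (star A * A) = hsSq A := by
  refine tsum_congr fun i => ?_
  rw [mul_apply_eq_comp, ContinuousLinearMap.star_eq_adjoint,
    ContinuousLinearMap.adjoint_inner_right, inner_self_eq_norm_sq, ENNReal.ofReal_pow
      (norm_nonneg _), ofReal_norm]

theorem isHilbertSchmidt_iff {A : H →L[𝕜] H} : IsHilbertSchmidt A ↔ hsSq A < ∞ := by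
  rw [IsHilbertSchmidt, trace_star_mul_self]

theorem isHilbertSchmidt_iff_summable {ι : Type*} (b : HilbertBasis ι 𝕜 H) {A : H →L[𝕜] H} :
    IsHilbertSchmidt A ↔ Summable fun i => ‖A (b i)‖ ^ 2 := by
  rw [isHilbertSchmidt_iff, hsSq_eq_tsum b]
  constructor
  · intro h
    have := ENNReal.summable_toReal h.ne
    simpa using this
  · intro h
    have := h.tsum_ofReal_lt_top
    simpa [ENNReal.ofReal_pow] using this

theorem hsSq_mul_le (B A : H →L[𝕜] H) : hsSq (B * A) ≤ ‖B‖ₑ ^ 2 * hsSq A := by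
  unfold hsSq
  rw [← ENNReal.tsum_mul_left]
  refine ENNReal.tsum_le_tsum fun i => ?_
  rw [← mul_pow]
  gcongr
  exact B.le_opENorm _

namespace IsHilbertSchmidt

variable {A B : H →L[𝕜] H}

theorem mul_left (hA : IsHilbertSchmidt A) (B : H →L[𝕜] H) : IsHilbertSchmidt (B * A) := by
  rw [isHilbertSchmidt_iff] at *
  exact (hsSq_mul_le B A).trans_lt (ENNReal.mul_lt_top (by simp) hA)

theorem star (hA : IsHilbertSchmidt A) : IsHilbertSchmidt (star A) := by
  rw [isHilbertSchmidt_iff] at *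
  rwa [hsSq_star]

theorem mul_right (hA : IsHilbertSchmidt A) (B : H →L[𝕜] H) : IsHilbertSchmidt (A * B) := by
  have := (hA.star.mul_left (Star.star B)).star
  rwa [star_mul, star_star, star_star] at this

theorem smul (hA : IsHilbertSchmidt A) (c : 𝕜) : IsHilbertSchmidt (c • A) := by
  simpa using hA.mul_left (c • 1)

theorem neg (hA : IsHilbertSchmidt A) : IsHilbertSchmidt (-A) := by
  simpa using hA.mul_left (-1)

theorem add (hA : IsHilbertSchmidt A) (hB : IsHilbertSchmidt B) : IsHilbertSchmidt (A + B) := by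
  rw [isHilbertSchmidt_iff_summable (basis 𝕜 H)] at *
  refine .of_nonneg_of_le (fun i => sq_nonneg _) (fun i => ?_) ((hA.add hB).mul_left 2)
  rw [add_apply]
  nlinarith [norm_add_le (A (basis 𝕜 H i)) (B (basis 𝕜 H i)), norm_nonneg (A (basis 𝕜 H i) +
    B (basis 𝕜 H i)), sq_nonneg (‖A (basis 𝕜 H i)‖ - ‖B (basis 𝕜 H i)‖)]

theorem sub (hA : IsHilbertSchmidt A) (hB : IsHilbertSchmidt B) : IsHilbertSchmidt (A - B) := by
  simpa [sub_eq_add_neg] using hA.add hB.neg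

theorem zero : IsHilbertSchmidt (0 : H →L[𝕜] H) := by
  simp [isHilbertSchmidt_iff, hsSq]

end IsHilbertSchmidt

/-! ### Scalar plus Hilbert–Schmidt operators. -/

theorem infinite_of_hilbertBasis {E : Type*} [NormedAddCommGroup E] [InnerProductSpace 𝕜 E]
    {ι : Type*} (b : HilbertBasis ι 𝕜 E) (hE : ¬ FiniteDimensional 𝕜 E) : Infinite ι := by
  refine not_finite_iff_infinite.mp fun h => hE ?_
  have := Fintype.ofFinite ι
  exact b.toOrthonormalBasis.toBasis.finiteDimensional_of_finite

theorem IsHilbertSchmidt.eq_zero_of_smul_one (hH : ¬ FiniteDimensional 𝕜 H) {c : 𝕜}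
    (h : IsHilbertSchmidt (c • (1 : H →L[𝕜] H))) : c = 0 := by
  have := infinite_of_hilbertBasis (basis 𝕜 H) hH
  rw [isHilbertSchmidt_iff_summable (basis 𝕜 H)] at h
  simpa [norm_smul, (basis 𝕜 H).orthonormal.1, summable_const_iff] using h

/-- `A` is the sum of the scalar operator `c` and a Hilbert–Schmidt operator. -/
def HasScalarPart (A : H →L[𝕜] H) (c : 𝕜) : Prop := IsHilbertSchmidt (A - c • (1 : H →L[𝕜] H))

namespace HasScalarPart

variable {A B : H →L[𝕜] H} {a b : 𝕜}

theorem unique (hH : ¬ FiniteDimensional 𝕜 H) (h : HasScalarPart A a) (h' : HasScalarPart A b) :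
    a = b := by
  have := IsHilbertSchmidt.sub h' h
  rw [sub_sub_sub_cancel_left, ← sub_smul] at this
  exact sub_eq_zero.mp (this.eq_zero_of_smul_one hH)

theorem mul (hA : HasScalarPart A a) (hB : HasScalarPart B b) : HasScalarPart (A * B) (a * b) := by
  have := (IsHilbertSchmidt.mul_right hA B).add (IsHilbertSchmidt.smul hB a)
  unfold HasScalarPart
  convert this using 1
  simp only [sub_mul, smul_sub, smul_mul_assoc, one_mul, smul_smul]
  abel

theorem sub (hA : HasScalarPart A a) (hB : HasScalarPart B b) : HasScalarPart (A - B) (a - b) := by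
  have := IsHilbertSchmidt.sub hA hB
  unfold HasScalarPart
  convert this using 1
  rw [sub_smul]
  abel

theorem star (hA : HasScalarPart A a) : HasScalarPart (star A) (starRingEnd 𝕜 a) := by
  have := IsHilbertSchmidt.star hA
  rwa [star_sub, star_smul, star_one] at this

theorem smul (hA : HasScalarPart A a) (c : 𝕜) : HasScalarPart (c • A) (c * a) := by
  have := IsHilbertSchmidt.smul hA c
  rwa [smul_sub, smul_smul] at this

/-- `B - a⁻¹ = -a⁻¹ B (A - a)`. -/
theorem inverse (hA : HasScalarPart A a) (ha : a ≠ 0) (h : B * A = 1) :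
    HasScalarPart B a⁻¹ := by
  have := (IsHilbertSchmidt.mul_left hA B).smul (-a⁻¹)
  unfold HasScalarPart
  convert this using 1
  rw [mul_sub, h, smul_sub, mul_smul_comm, smul_smul, mul_one, neg_mul, inv_mul_cancel₀ ha]
  simp only [neg_smul, one_smul]
  abel

end HasScalarPart

theorem hasScalarPart_zero_iff {A : H →L[𝕜] H} : HasScalarPart A 0 ↔ IsHilbertSchmidt A := by
  simp [HasScalarPart]

theorem hasScalarPart_one : HasScalarPart (1 : H →L[𝕜] H) 1 := by
  simpa [HasScalarPart] using IsHilbertSchmidt.zero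

theorem hasScalarPart_smul_one (c : 𝕜) : HasScalarPart (c • (1 : H →L[𝕜] H)) c := by
  simpa [HasScalarPart] using IsHilbertSchmidt.zero

/-! ### Compactness, eigenbases and diagonal operators. -/

theorem enorm_sq_le_hsSq (A : H →L[𝕜] H) : ‖A‖ₑ ^ 2 ≤ hsSq A := by
  by_cases hA : hsSq A = ∞
  · simp [hA]
  have key : ∀ x, ‖A x‖ ^ 2 ≤ (hsSq A).toReal * ‖x‖ ^ 2 := fun x => by
    have h1 := tsum_enorm_inner_sq (basis 𝕜 H) (A x)
    have h2 : ‖A x‖ₑ ^ 2 ≤ hsSq A * ‖x‖ₑ ^ 2 := by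
      rw [← h1, hsSq_eq_tsum_star (basis 𝕜 H), ← ENNReal.tsum_mul_right]
      refine ENNReal.tsum_le_tsum fun i => ?_
      rw [← mul_pow]
      gcongr
      rw [← ContinuousLinearMap.adjoint_inner_left, ← ContinuousLinearMap.star_eq_adjoint]
      rw [← ofReal_norm, ← ofReal_norm, ← ofReal_norm, ← ENNReal.ofReal_mul (norm_nonneg _)]
      exact ENNReal.ofReal_le_ofReal (norm_inner_le_norm _ _)
    have := ENNReal.toReal_mono (ENNReal.mul_ne_top hA (by simp)) h2
    simpa using this
  have : ‖A‖ ≤ √(hsSq A).toReal := by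
    refine A.opNorm_le_bound (Real.sqrt_nonneg _) fun x => ?_
    refine abs_le_of_sq_le_sq' ?_ (by positivity) |>.2
    rw [mul_pow, Real.sq_sqrt ENNReal.toReal_nonneg]
    exact key x
  have h3 : ‖A‖ ^ 2 ≤ (hsSq A).toReal := by
    rw [← Real.sq_sqrt (ENNReal.toReal_nonneg (a := hsSq A))]
    gcongr
  have h4 := ENNReal.ofReal_le_ofReal h3
  rwa [ENNReal.ofReal_toReal hA, ENNReal.ofReal_pow (norm_nonneg _), ofReal_norm] at h4

/-- `A` is the norm limit of its finite-rank truncations `F s`: the squared Hilbert–Schmidt norm of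
`A - F s` is a tail of a convergent sum and dominates the squared operator norm. -/
theorem IsHilbertSchmidt.isCompactOperator {A : H →L[𝕜] H} (hA : IsHilbertSchmidt A) :
    IsCompactOperator A := by
  classical
  let F : Finset (basisIndex 𝕜 H) → H →L[𝕜] H := fun s =>
    ∑ i ∈ s, (innerSL 𝕜 (basis 𝕜 H i)).smulRight (A (basis 𝕜 H i))
  have hF : ∀ s, IsCompactOperator (F s) := fun s =>
    (compactOperator (RingHom.id 𝕜) H H).sum_mem fun i _ =>
      ((isCompactOperator_id_iff_locallyCompactSpace (E := 𝕜)).mpr inferInstance).comp_clm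
        (innerSL 𝕜 (basis 𝕜 H i)) |>.clm_comp
        (ContinuousLinearMap.toSpanSingleton 𝕜 (A (basis 𝕜 H i)))
  have hFb : ∀ s j, (A - F s) (basis 𝕜 H j) = if j ∈ s then 0 else A (basis 𝕜 H j) := by
    intro s j
    simp only [F, sub_apply, sum_apply,
      ContinuousLinearMap.smulRight_apply, innerSL_apply_apply,
      orthonormal_iff_ite.mp (basis 𝕜 H).orthonormal]
    by_cases hj : j ∈ s <;> simp [hj]
  have hlim : Filter.Tendsto (fun s => hsSq (A - F s)) Filter.atTop (nhds 0) := by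
    have h := ENNReal.tendsto_tsum_compl_atTop_zero (f := fun i => ‖A (basis 𝕜 H i)‖ₑ ^ 2)
      (isHilbertSchmidt_iff.mp hA).ne
    refine h.congr fun s => ?_
    refine (tsum_subtype {i | i ∉ s} (fun i => ‖A (basis 𝕜 H i)‖ₑ ^ 2)).trans ?_
    rw [hsSq]
    refine tsum_congr fun j => ?_
    rw [hFb]
    by_cases hj : j ∈ s <;> simp [hj]
  refine isCompactOperator_of_tendsto (F := F) (l := Filter.atTop) ?_ (.of_forall hF)
  have h1 := (ENNReal.tendsto_toReal ENNReal.zero_ne_top).comp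
    (tendsto_of_tendsto_of_tendsto_of_le_of_le tendsto_const_nhds hlim (fun _ => zero_le)
      fun s => enorm_sq_le_hsSq (A - F s))
  have h2 := (Real.continuous_sqrt.tendsto _).comp h1
  rw [tendsto_iff_norm_sub_tendsto_zero]
  simpa [Function.comp_def, norm_sub_rev] using h2

theorem clm_ext_hilbertBasis {E : Type*} [NormedAddCommGroup E] [InnerProductSpace 𝕜 E]
    {ι : Type*} (b : HilbertBasis ι 𝕜 E) {S T : E →L[𝕜] E}
    (h : ∀ i, S (b i) = T (b i)) : S = T :=
  ContinuousLinearMap.ext_on (Submodule.dense_iff_topologicalClosure_eq_top.mpr b.dense_span)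
    (by rintro _ ⟨i, rfl⟩; exact h i)

theorem eq_zero_of_inner_hilbertBasis {E : Type*} [NormedAddCommGroup E] [InnerProductSpace 𝕜 E]
    {ι : Type*} (b : HilbertBasis ι 𝕜 E) {x : E}
    (h : ∀ i, inner 𝕜 (b i) x = 0) : x = 0 := by
  have := hasSum_norm_inner_sq b x
  simp only [h, norm_zero, ne_eq, OfNat.ofNat_ne_zero, not_false_eq_true, zero_pow] at this
  simpa using this.unique hasSum_zero

/-- A compact self-adjoint operator is diagonal in some Hilbert basis. -/
theorem exists_eigenbasis {T : H →L[𝕜] H} (hc : IsCompactOperator T) (hT : IsSelfAdjoint T) :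
    ∃ (w : Set H) (b : HilbertBasis w 𝕜 H) (l : w → ℝ), ∀ i, T (b i) = (l i : 𝕜) • b i := by
  have hsym : T.IsSymmetric := hT.isSymmetric
  have hfam := LinearMap.IsSymmetric.orthogonalFamily_eigenspaces hsym
  have hcs : ∀ μ, CompleteSpace (Module.End.eigenspace (T : Module.End 𝕜 H) μ) := fun μ => by
    have : (Module.End.eigenspace (T : Module.End 𝕜 H) μ : Set H) = {x | T x = μ • x} := by
      ext x; simp
    have hcl : IsClosed (Module.End.eigenspace (T : Module.End 𝕜 H) μ : Set H) := by
      rw [this]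
      exact isClosed_eq T.continuous (continuous_const_smul μ)
    exact hcl.completeSpace_coe
  -- Hilbert bases of all the eigenspaces, glued together; they span densely because the eigenspaces
  -- of a compact self-adjoint operator have trivial joint orthogonal complement.
  choose w e he using fun μ : 𝕜 =>
    exists_hilbertBasis 𝕜 (Module.End.eigenspace (T : Module.End 𝕜 H) μ)
  let v : (Σ μ, w μ) → H := fun p => (e p.1 p.2 : H)
  have hv : Orthonormal 𝕜 v :=
    hfam.orthonormal_sigma_orthonormal (v_family := fun μ => e μ) fun μ => (e μ).orthonormal
  have hperp : (Submodule.span 𝕜 (Set.range v))ᗮ = ⊥ := by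
    rw [eq_bot_iff, ← ContinuousLinearMap.orthogonalComplement_iSup_eigenspaces_eq_bot hc hsym]
    intro x hx
    rw [← Submodule.iInf_orthogonal, Submodule.mem_iInf]
    intro μ
    have h0 : (innerSL 𝕜 x).comp (Module.End.eigenspace (T : Module.End 𝕜 H) μ).subtypeL = 0 := by
      refine ContinuousLinearMap.ext_on
        (Submodule.dense_iff_topologicalClosure_eq_top.mpr (e μ).dense_span) ?_
      rintro _ ⟨j, rfl⟩
      exact (Submodule.mem_orthogonal' _ _).mp hx (v ⟨μ, j⟩) (Submodule.subset_span ⟨_, rfl⟩)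
    rw [Submodule.mem_orthogonal']
    exact fun y hy => DFunLike.congr_fun h0 ⟨y, hy⟩
  have hmem : ∀ p, T (v p) = ((RCLike.re p.1 : ℝ) : 𝕜) • v p := by
    rintro ⟨μ, j⟩
    have h1 : T (v ⟨μ, j⟩) = μ • v ⟨μ, j⟩ := Module.End.mem_eigenspace_iff.mp (e μ j).2
    have h2 : Module.End.HasEigenvalue (T : Module.End 𝕜 H) μ :=
      Module.End.hasEigenvalue_of_hasEigenvector (x := v ⟨μ, j⟩)
        ⟨(e μ j).2, hv.ne_zero _⟩
    rw [h1, RCLike.conj_eq_iff_re.mp (hsym.conj_eigenvalue_eq_self h2)]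
  choose f hf using fun i : Set.range v => i.2
  refine ⟨Set.range v, HilbertBasis.mkOfOrthogonalEqBot hv.toSubtypeRange
    (by rwa [Subtype.range_coe]), fun i => RCLike.re (f i).1, fun i => ?_⟩
  rw [HilbertBasis.coe_mkOfOrthogonalEqBot, ← hf i]
  exact hmem _

theorem exists_diagonal {ι : Type*} (b : HilbertBasis ι 𝕜 H) (l : ι → ℝ) {M : ℝ}
    (hl : ∀ i, |l i| ≤ M) :
    ∃ S : H →L[𝕜] H, IsSelfAdjoint S ∧ ∀ i, S (b i) = (l i : 𝕜) • b i := by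
  classical
  have hmem : ∀ x : H, Memℓp (fun i => (l i : 𝕜) * b.repr x i) 2 := fun x => by
    have h := (hasSum_norm_inner_sq b x).summable.mul_left (M ^ 2)
    refine memℓp_gen (.of_nonneg_of_le (fun i => by positivity) (fun i => ?_) h)
    rw [b.repr_apply_apply, ENNReal.toReal_ofNat, Real.rpow_two, norm_mul, mul_pow,
      RCLike.norm_ofReal]
    gcongr
    exact hl i
  let S : H →ₗ[𝕜] H :=
    { toFun := fun x => b.repr.symm ⟨_, hmem x⟩
      map_add' := fun x y => by
        rw [← map_add]
        congr 1
        ext i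
        simp [mul_add]
        rfl
      map_smul' := fun c x => by
        rw [RingHom.id_apply, ← map_smul]
        congr 1
        ext i
        simp [mul_left_comm] }
  have hS : ∀ x i, b.repr (S x) i = (l i : 𝕜) * b.repr x i := fun x i => by simp [S]
  have hsym : S.IsSymmetric := fun x y => by
    rw [← b.repr.inner_map_map, ← b.repr.inner_map_map, lp.inner_eq_tsum, lp.inner_eq_tsum]
    refine tsum_congr fun i => ?_
    rw [hS, hS]
    simp [mul_left_comm, mul_comm]
  -- Boundedness is the Hellinger–Toeplitz theorem: `S` is symmetric and defined everywhere.
  refine ⟨⟨S, hsym.continuous⟩, ?_, fun i => ?_⟩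
  · rw [ContinuousLinearMap.isSelfAdjoint_iff_isSymmetric]
    exact hsym
  · refine b.repr.injective ?_
    ext j
    change b.repr (S (b i)) j = _
    rw [hS, map_smul, b.repr_self]
    by_cases h : j = i
    · subst h; simp [RCLike.real_smul_eq_coe_mul]
    · simp [h]

/-! ### Real powers of positive definite unitized Hilbert–Schmidt operators. -/

theorem exists_abs_rpow_le (s : ℝ) {m M : ℝ} (hm : 0 < m) :
    ∃ B, ∀ x ∈ Set.Icc m M, |x ^ s| ≤ B := by
  have hc : ContinuousOn (fun x : ℝ => x ^ s) (Set.Icc m M) := fun x hx =>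
    (Real.continuousAt_rpow_const x s (.inl (hm.trans_le hx.1).ne')).continuousWithinAt
  exact isCompact_Icc.exists_bound_of_continuousOn hc

theorem exists_abs_rpow_sub_rpow_le (s : ℝ) {m M : ℝ} (hm : 0 < m) :
    ∃ L, ∀ x ∈ Set.Icc m M, ∀ y ∈ Set.Icc m M, |x ^ s - y ^ s| ≤ L * |x - y| := by
  obtain ⟨B, hB⟩ := exists_abs_rpow_le (s - 1) (M := M) hm
  refine ⟨|s| * B, fun x hx y hy => ?_⟩
  refine (convex_Icc m M).norm_image_sub_le_of_norm_hasDerivWithin_le (f := fun x : ℝ => x ^ s)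
    (f' := fun x => s * x ^ (s - 1)) (fun z hz => ?_) (fun z hz => ?_) hy hx
  · exact (Real.hasDerivAt_rpow_const (.inl (hm.trans_le hz.1).ne')).hasDerivWithinAt
  · rw [Real.norm_eq_abs, abs_mul]
    exact mul_le_mul_of_nonneg_left (hB z hz) (abs_nonneg s)

/-- A positive definite unitized Hilbert–Schmidt operator is diagonal in some Hilbert basis, with
eigenvalues in a compact subset of `(0, ∞)`, and converging to the scalar part. -/
theorem IsUnitizedHSPosDef.exists_eigenbasis (hH : ¬ FiniteDimensional 𝕜 H) {X : H →L[𝕜] H}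
    {δ : ℝ} (hX : IsUnitizedHSPosDef X δ) :
    ∃ (w : Set H) (b : HilbertBasis w 𝕜 H) (l : w → ℝ) (m M : ℝ), 0 < m ∧ δ ∈ Set.Icc m M ∧
      (∀ i, l i ∈ Set.Icc m M) ∧ (∀ i, shift X δ (b i) = (l i : 𝕜) • b i) ∧
      Summable fun i => (l i - δ) ^ 2 := by
  obtain ⟨w, b, k, hk⟩ :=
    AlphaProcrustes.exists_eigenbasis hX.isHilbertSchmidt.isCompactOperator hX.isSelfAdjoint
  obtain ⟨C, hC, hCx⟩ := hX.isPosDef.2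
  have hb : ∀ i, ‖b i‖ = 1 := b.orthonormal.1
  have hkX : ∀ i, |k i| ≤ ‖X‖ := fun i => by
    have := X.le_opNorm (b i)
    rwa [hk, norm_smul, hb, mul_one, mul_one, RCLike.norm_ofReal] at this
  have hshift : ∀ i, shift X δ (b i) = ((k i + δ : ℝ) : 𝕜) • b i := fun i => by
    rw [shift, add_apply, hk]
    simp [add_smul]
  have hlow : ∀ i, C ≤ k i + δ := fun i => by
    have := hCx (b i)
    rw [hshift, inner_smul_right, inner_self_eq_norm_sq_to_K, hb] at this
    simpa using this
  have hsum : Summable fun i => k i ^ 2 := by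
    have := (isHilbertSchmidt_iff_summable b).mp hX.isHilbertSchmidt
    simpa [hk, norm_smul, hb] using this
  have hinf := infinite_of_hilbertBasis b hH
  have hlim : Filter.Tendsto (fun i => |k i| + δ) Filter.cofinite (nhds (0 + δ)) := by
    refine Filter.Tendsto.add_const _ ?_
    have := (Real.continuous_sqrt.tendsto _).comp hsum.tendsto_cofinite_zero
    simpa [Function.comp_def, Real.sqrt_sq_eq_abs] using this
  -- The eigenvalues accumulate at `δ` because there are infinitely many indices, so the lower bound
  -- `C` passes to `δ`; in particular `δ > 0`.
  have hCδ : C ≤ δ := by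
    rw [zero_add] at hlim
    exact ge_of_tendsto' hlim fun i => (hlow i).trans (by gcongr; exact le_abs_self _)
  refine ⟨w, b, fun i => k i + δ, C, ‖X‖ + δ, hC, ⟨hCδ, by linarith [norm_nonneg X]⟩,
    fun i => ⟨hlow i, ?_⟩, hshift, by simpa using hsum⟩
  exact add_le_add_left ((le_abs_self _).trans (hkX i)) δ

theorem inner_eigenvector {T : H →L[𝕜] H} (hT : IsSelfAdjoint T) {v : H} {l : ℝ}
    (h : T v = (l : 𝕜) • v) (x : H) : inner 𝕜 v (T x) = (l : 𝕜) * inner 𝕜 v x := by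
  rw [← hT.isSymmetric.apply_clm v x, h, inner_smul_left, RCLike.conj_ofReal]

/-- An eigenvector for `t` has nonzero coefficients only at indices with `l i = t`, where `S`
multiplies by `t ^ s`. -/
theorem isPower_of_eigenbasis {ι : Type*} (b : HilbertBasis ι 𝕜 H) {T S : H →L[𝕜] H} {l : ι → ℝ}
    {s : ℝ} (hT : IsSelfAdjoint T) (hS : IsSelfAdjoint S) (hTb : ∀ i, T (b i) = (l i : 𝕜) • b i)
    (hSb : ∀ i, S (b i) = ((l i ^ s : ℝ) : 𝕜) • b i) : IsPower T s S := by
  intro t x hx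
  rw [← sub_eq_zero]
  refine eq_zero_of_inner_hilbertBasis b fun i => ?_
  have h := inner_eigenvector hT (hTb i) x
  rw [hx, inner_smul_right] at h
  rw [inner_sub_right, inner_eigenvector hS (hSb i), inner_smul_right, ← sub_mul]
  rcases eq_or_ne (inner 𝕜 (b i) x) 0 with h0 | h0
  · rw [h0, mul_zero]
  · rw [RCLike.ofReal_injective (mul_right_cancel₀ h0 h), sub_self, zero_mul]

/-- The power of a positive definite unitized Hilbert–Schmidt operator, in an eigenbasis. -/
theorem power_apply_eigenbasis {ι : Type*} (b : HilbertBasis ι 𝕜 H) {T : H →L[𝕜] H} {l : ι → ℝ}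
    {m M : ℝ} (s : ℝ) (hT : IsSelfAdjoint T) (hm : 0 < m) (hl : ∀ i, l i ∈ Set.Icc m M)
    (hTb : ∀ i, T (b i) = (l i : 𝕜) • b i) :
    IsSelfAdjoint (power T s) ∧ ∀ i, power T s (b i) = ((l i ^ s : ℝ) : 𝕜) • b i := by
  obtain ⟨B, hB⟩ := exists_abs_rpow_le s (M := M) hm
  obtain ⟨S, hS, hSb⟩ := exists_diagonal b (fun i => l i ^ s) fun i => hB _ (hl i)
  have hex : ∃ S, IsPower T s S := ⟨S, isPower_of_eigenbasis b hT hS hTb hSb⟩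
  have hpow : ∀ i, power T s (b i) = ((l i ^ s : ℝ) : 𝕜) • b i := fun i => by
    rw [power, dif_pos hex]
    exact hex.choose_spec (l i) (b i) (hTb i)
  have : power T s = S := clm_ext_hilbertBasis b fun i => (hpow i).trans (hSb i).symm
  exact ⟨this ▸ hS, hpow⟩

/-- The inverse is the power `-s`. For the scalar part, `x ^ s` is Lipschitz on an interval `[m, M]`
with `m > 0` containing `δ` and all eigenvalues, so square-summability passes from `l i - δ` to `l i
^ s - δ ^ s`. -/
theorem IsUnitizedHSPosDef.power_spec (hH : ¬ FiniteDimensional 𝕜 H) {X : H →L[𝕜] H} {δ : ℝ}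
    (hX : IsUnitizedHSPosDef X δ) (s : ℝ) :
    IsSelfAdjoint (power (shift X δ) s) ∧ IsUnit (power (shift X δ) s) ∧
      HasScalarPart (power (shift X δ) s) ((δ ^ s : ℝ) : 𝕜) := by
  obtain ⟨w, b, l, m, M, hm, hδ, hl, hb, hsum⟩ := hX.exists_eigenbasis hH
  have hP := fun s => power_apply_eigenbasis b s hX.isPosDef.1 hm hl hb
  have hinv : ∀ s, power (shift X δ) s * power (shift X δ) (-s) = 1 := fun s => by
    refine clm_ext_hilbertBasis b fun i => ?_
    rw [mul_apply_eq_comp, (hP _).2, map_smul, (hP _).2, smul_smul, ← RCLike.ofReal_mul,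
      ← Real.rpow_add (hm.trans_le (hl i).1)]
    simp
  refine ⟨(hP s).1, ⟨⟨_, _, hinv s, by simpa using hinv (-s)⟩, rfl⟩, ?_⟩
  obtain ⟨L, hL⟩ := exists_abs_rpow_sub_rpow_le s (M := M) hm
  rw [HasScalarPart, isHilbertSchmidt_iff_summable b]
  refine .of_nonneg_of_le (fun i => sq_nonneg _) (fun i => ?_) (hsum.mul_left (L ^ 2))
  have h1 : (power (shift X δ) s - ((δ ^ s : ℝ) : 𝕜) • (1 : H →L[𝕜] H)) (b i) =
      ((l i ^ s - δ ^ s : ℝ) : 𝕜) • b i := by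
    rw [sub_apply, (hP s).2, RCLike.ofReal_sub, sub_smul]
    simp
  rw [h1, norm_smul, b.orthonormal.1, mul_one, RCLike.norm_ofReal, ← sq_abs (l i - δ), ← mul_pow]
  exact pow_le_pow_left₀ (abs_nonneg _) (hL _ (hl i) _ hδ) 2

theorem IsUnitizedHSPosDef.inverse_shift (hH : ¬ FiniteDimensional 𝕜 H) {X : H →L[𝕜] H} {δ : ℝ}
    (hX : IsUnitizedHSPosDef X δ) :
    Ring.inverse (shift X δ) = power (shift X δ) (-1 / 2) * power (shift X δ) (-1 / 2) := by
  obtain ⟨w, b, l, m, M, hm, hδ, hl, hb, hsum⟩ := hX.exists_eigenbasis hH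
  have hP := (power_apply_eigenbasis b (-1 / 2) hX.isPosDef.1 hm hl hb).2
  have hl1 : ∀ i, l i ^ (-1 / 2 : ℝ) * (l i ^ (-1 / 2 : ℝ) * l i) = 1 := fun i => by
    have h0 := hm.trans_le (hl i).1
    rw [← mul_assoc, ← Real.rpow_add h0]
    norm_num [Real.rpow_neg_one, h0.ne']
  have h1 : power (shift X δ) (-1 / 2) * power (shift X δ) (-1 / 2) * shift X δ = 1 := by
    refine clm_ext_hilbertBasis b fun i => ?_
    rw [mul_apply_eq_comp, mul_apply_eq_comp, hb, map_smul, hP, map_smul, map_smul, hP, smul_smul,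
      smul_smul, ← RCLike.ofReal_mul, ← RCLike.ofReal_mul]
    rw [mul_assoc, mul_comm, mul_assoc, hl1]
    simp
  have h2 : shift X δ * (power (shift X δ) (-1 / 2) * power (shift X δ) (-1 / 2)) = 1 := by
    refine clm_ext_hilbertBasis b fun i => ?_
    rw [mul_apply_eq_comp, mul_apply_eq_comp, hP, map_smul, hP, map_smul, map_smul, hb, smul_smul,
      smul_smul, ← RCLike.ofReal_mul, ← RCLike.ofReal_mul, mul_assoc, hl1]
    simp
  exact Ring.inverse_unit (⟨_, _, h2, h1⟩ : (H →L[𝕜] H)ˣ)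

/-! ### Hilbert–Schmidt inner product and the optimality criterion. -/

/-- The real part of the Hilbert–Schmidt inner product. -/
def hsInner (A B : H →L[𝕜] H) : ℝ :=
  ∑' i, RCLike.re (inner 𝕜 (A (basis 𝕜 H i)) (B (basis 𝕜 H i)))

section hsInner

variable {A B C : H →L[𝕜] H}

theorem summable_hsInner (hA : IsHilbertSchmidt A) (hB : IsHilbertSchmidt B) :
    Summable fun i => RCLike.re (inner 𝕜 (A (basis 𝕜 H i)) (B (basis 𝕜 H i))) := by
  rw [isHilbertSchmidt_iff_summable (basis 𝕜 H)] at hA hB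
  refine .of_norm_bounded (hA.add hB) fun i => ?_
  have h1 := (RCLike.abs_re_le_norm _).trans
    (norm_inner_le_norm (𝕜 := 𝕜) (A (basis 𝕜 H i)) (B (basis 𝕜 H i)))
  rw [Real.norm_eq_abs]
  nlinarith [sq_nonneg (‖A (basis 𝕜 H i)‖ - ‖B (basis 𝕜 H i)‖),
    sq_nonneg (‖A (basis 𝕜 H i)‖ + ‖B (basis 𝕜 H i)‖)]

theorem hsInner_add_right (hA : IsHilbertSchmidt A) (hB : IsHilbertSchmidt B)
    (hC : IsHilbertSchmidt C) : hsInner A (B + C) = hsInner A B + hsInner A C := by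
  unfold hsInner
  rw [← (summable_hsInner hA hB).tsum_add (summable_hsInner hA hC)]
  simp [inner_add_right]

theorem hsInner_neg_right (A B : H →L[𝕜] H) : hsInner A (-B) = -hsInner A B := by
  simp [hsInner, tsum_neg]

theorem hsInner_comm (A B : H →L[𝕜] H) : hsInner A B = hsInner B A :=
  tsum_congr fun _ => inner_re_symm _ _

theorem hsInner_mul_left (A B C : H →L[𝕜] H) : hsInner (B * A) C = hsInner A (star B * C) :=
  tsum_congr fun _ => by
    rw [mul_apply_eq_comp, mul_apply_eq_comp, ContinuousLinearMap.star_eq_adjoint,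
      ContinuousLinearMap.adjoint_inner_right]

theorem hsInner_self (A : H →L[𝕜] H) : hsInner A A = (hsSq A).toReal := by
  rw [hsSq, ENNReal.tsum_toReal_eq (by simp)]
  exact tsum_congr fun i => by simp

theorem hsInner_add_add (hA : IsHilbertSchmidt A) (hB : IsHilbertSchmidt B) :
    (hsSq (A + B)).toReal = (hsSq A).toReal + (hsSq B).toReal + 2 * hsInner A B := by
  rw [← hsInner_self A, ← hsInner_self B, ← hsInner_self (A + B),
    hsInner_add_right (hA.add hB) hA hB, hsInner_comm, hsInner_comm (A + B),
    hsInner_add_right hA hA hB, hsInner_add_right hB hA hB, hsInner_comm B A]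
  ring

/-- By polarisation, from the invariance of the norm under the adjoint. -/
theorem hsInner_star_star (hA : IsHilbertSchmidt A) (hB : IsHilbertSchmidt B) :
    hsInner (star A) (star B) = hsInner A B := by
  have h1 := hsInner_add_add hA hB
  have h2 := hsInner_add_add hA.star hB.star
  rw [← star_add, hsSq_star, hsSq_star, hsSq_star] at h2
  linarith

theorem hsInner_nonneg_of_nonneg {Q : H →L[𝕜] H} (hQ : ∀ x, 0 ≤ RCLike.re (inner 𝕜 x (Q x)))
    (T : H →L[𝕜] H) : 0 ≤ hsInner T (Q * T) :=
  tsum_nonneg fun _ => hQ _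

/-- Unitarity of `1 + T` reads `T + T* = -T T*`, and `⟨J, T⟩ = ⟨J, T*⟩` in real part since `J` is
self-adjoint. This trades the linear term of the expansion below for a quadratic one. -/
theorem two_mul_hsInner_of_unitary {J T : H →L[𝕜] H} (hJ : IsHilbertSchmidt J)
    (hJs : IsSelfAdjoint J) (hT : IsHilbertSchmidt T) (hU : 1 + T ∈ unitary (H →L[𝕜] H)) :
    2 * hsInner J T = -hsInner (J * T) T := by
  have h1 : T + star T = -(T * star T) := by
    have := Unitary.mul_star_self_of_mem hU
    rw [star_add, star_one, add_mul, one_mul, mul_add, mul_one] at this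
    rw [eq_neg_iff_add_eq_zero, ← sub_eq_zero.mpr this]
    abel
  have h2 : hsInner J (star T) = hsInner J T := by
    conv_lhs => rw [← hJs.star_eq]
    exact hsInner_star_star hJ hT
  have h3 : hsInner J (T * star T) = hsInner (J * T) T := by
    rw [hsInner_comm, hsInner_mul_left, hsInner_comm,
      ← hsInner_star_star (hT.mul_left J) hT, star_mul, hJs.star_eq]
  rw [two_mul, ← h3, ← hsInner_neg_right, ← h1, hsInner_add_right hJ hT hT.star, h2]

/-- If `C* G ≥ 0`, then `1` minimizes `‖C - G W‖` over the unitary operators `W` for which `W - 1`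
is Hilbert–Schmidt. -/
theorem hsSq_sub_le_of_nonneg {C G T : H →L[𝕜] H} (hCG : IsHilbertSchmidt (C - G))
    (hs : IsSelfAdjoint (star C * G)) (hp : ∀ x, 0 ≤ RCLike.re (inner 𝕜 x ((star C * G) x)))
    (hT : IsHilbertSchmidt T) (hU : 1 + T ∈ unitary (H →L[𝕜] H)) :
    hsSq (C - G) ≤ hsSq (C - G * (1 + T)) := by
  set J := star G * G - star C * G with hJ
  have hJ2 : star G * (C - G) = -J := by
    have := hs.star_eq
    rw [star_mul, star_star] at this
    rw [hJ, mul_sub, this, neg_sub]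
  have hJs : IsSelfAdjoint J := (IsSelfAdjoint.star_mul_self G).sub hs
  have hJHS : IsHilbertSchmidt J := by
    simpa [hJ2] using (hCG.mul_left (star G)).neg
  have hGT := hT.mul_left G
  have e1 : C - G * (1 + T) = (C - G) + -(G * T) := by rw [mul_add, mul_one]; abel
  have e2 := hsInner_add_add hCG hGT.neg
  have e3 : hsInner (C - G) (-(G * T)) = hsInner J T := by
    rw [hsInner_neg_right, hsInner_comm, hsInner_mul_left, hJ2, hsInner_neg_right, neg_neg,
      hsInner_comm]
  have e4 : (hsSq (-(G * T))).toReal = hsInner T (star C * G * T) + hsInner (J * T) T := by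
    have : hsSq (-(G * T)) = hsSq (G * T) := by simp [hsSq]
    rw [this, ← hsInner_self (G * T), hsInner_mul_left, hsInner_comm (J * T),
      ← hsInner_add_right hT (hT.mul_left _) (hT.mul_left _), ← add_mul, hJ, ← mul_assoc]
    congr 2
    abel
  have e5 := two_mul_hsInner_of_unitary hJHS hJs hT hU
  have e6 := hsInner_nonneg_of_nonneg hp T
  rw [e1, ← ENNReal.toReal_le_toReal (isHilbertSchmidt_iff.mp hCG).ne
    (isHilbertSchmidt_iff.mp (hCG.add hGT.neg)).ne, e2, e3, e4]
  linarith

end hsInner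

/-! ### Kernels and polar decomposition. -/

/-- Two finite-dimensional inner product spaces of the same dimension are isometric. -/
theorem nonempty_linearIsometryEquiv {E F : Type*} [NormedAddCommGroup E] [InnerProductSpace 𝕜 E]
    [NormedAddCommGroup F] [InnerProductSpace 𝕜 F] [FiniteDimensional 𝕜 F] (g : E ≃ₗ[𝕜] F) :
    Nonempty (E ≃ₗᵢ[𝕜] F) := by
  have := g.symm.finiteDimensional
  exact ⟨(stdOrthonormalBasis 𝕜 E).equiv (stdOrthonormalBasis 𝕜 F) (finCongr g.finrank_eq)⟩

/-- The kernel is the eigenspace of the compact operator `N - a` for the nonzero eigenvalue `-a`. -/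
theorem HasScalarPart.finiteDimensional_ker {N : H →L[𝕜] H} {a : 𝕜} (hN : HasScalarPart N a)
    (ha : a ≠ 0) : FiniteDimensional 𝕜 (LinearMap.ker N.toLinearMap) := by
  have h := ContinuousLinearMap.finite_dimensional_eigenspace
    (IsHilbertSchmidt.isCompactOperator hN) (-a) (neg_ne_zero.mpr ha)
  have h2 : Module.End.eigenspace (N - a • (1 : H →L[𝕜] H)).toLinearMap (-a) =
      LinearMap.ker N.toLinearMap := by
    ext x
    simp [sub_eq_add_neg]
  rwa [h2] at h

/-- An isometry between the kernels of `N*` and `N`, where `N` is similar to `N*` up to units. -/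
theorem nonempty_ker_star_isometry {N L J : H →L[𝕜] H} {a : 𝕜} (hN : HasScalarPart N a)
    (ha : a ≠ 0) (hL : IsUnit L) (hJ : IsUnit J) (h : N * L = J * star N) :
    Nonempty (LinearMap.ker (star N).toLinearMap ≃ₗᵢ[𝕜] LinearMap.ker N.toLinearMap) := by
  obtain ⟨L, rfl⟩ := hL
  obtain ⟨J, rfl⟩ := hJ
  have := hN.finiteDimensional_ker ha
  have h2 : (↑J⁻¹ : H →L[𝕜] H) * N = star N * ↑L⁻¹ := by
    rw [Units.inv_mul_eq_iff_eq_mul, ← mul_assoc, ← h, Units.mul_inv_cancel_right]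
  have hL1 : ∀ x, (L : H →L[𝕜] H) ((↑L⁻¹ : H →L[𝕜] H) x) = x := fun x => by
    rw [← mul_apply_eq_comp, L.mul_inv]; rfl
  have hL2 : ∀ x, (↑L⁻¹ : H →L[𝕜] H) ((L : H →L[𝕜] H) x) = x := fun x => by
    rw [← mul_apply_eq_comp, L.inv_mul]; rfl
  -- `L` maps `ker N*` into `ker N` and `L⁻¹` maps back. This bijection need not be isometric, but
  -- it shows equality of the finite dimensions.
  refine nonempty_linearIsometryEquiv (LinearEquiv.ofLinearMap
    ((L : H →L[𝕜] H).toLinearMap.restrict fun x hx => ?_)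
    ((↑L⁻¹ : H →L[𝕜] H).toLinearMap.restrict fun x hx => ?_) ?_ ?_)
  · have := DFunLike.congr_fun h x
    simp only [mul_apply_eq_comp] at this
    have hx' : star N x = 0 := hx
    rw [hx', map_zero] at this
    exact this
  · have := DFunLike.congr_fun h2 x
    simp only [mul_apply_eq_comp] at this
    have hx' : N x = 0 := hx
    rw [hx', map_zero] at this
    exact this.symm
  · ext x
    exact hL1 _
  · ext x
    exact hL2 _

theorem mem_unitary_of_linearIsometryEquiv (e : H ≃ₗᵢ[𝕜] H) :
    (e : H →L[𝕜] H) ∈ unitary (H →L[𝕜] H) :=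
  (Unitary.linearIsometryEquiv.symm e).2

/-- Polar decomposition: a scalar plus Hilbert–Schmidt operator `N`, with isometric kernels of `N`
and `N*`, becomes positive after multiplication with a suitable unitary operator `W`, for which
`W - 1` is Hilbert–Schmidt. -/
theorem exists_unitary_mul_nonneg {N : H →L[𝕜] H} {a : ℝ} (ha : 0 < a)
    (hN : HasScalarPart N (a : 𝕜))
    (u : LinearMap.ker (star N).toLinearMap ≃ₗᵢ[𝕜] LinearMap.ker N.toLinearMap) :
    ∃ W ∈ unitary (H →L[𝕜] H), HasScalarPart W 1 ∧ IsSelfAdjoint (N * W) ∧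
      ∀ x, 0 ≤ RCLike.re (inner 𝕜 x ((N * W) x)) := by
  classical
  have hadj : ∀ x y, inner 𝕜 (star N x) y = inner 𝕜 x (N y) := fun x y => by
    rw [ContinuousLinearMap.star_eq_adjoint, ContinuousLinearMap.adjoint_inner_left]
  have hadj' : ∀ x y, inner 𝕜 y (star N x) = inner 𝕜 (N y) x := fun x y => by
    rw [ContinuousLinearMap.star_eq_adjoint, ContinuousLinearMap.adjoint_inner_right]
  have hK : IsHilbertSchmidt (N * star N - ((a ^ 2 : ℝ) : 𝕜) • (1 : H →L[𝕜] H)) := by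
    have := hN.mul hN.star
    rwa [RCLike.conj_ofReal, ← RCLike.ofReal_mul, ← sq] at this
  have hKs : IsSelfAdjoint (N * star N - ((a ^ 2 : ℝ) : 𝕜) • (1 : H →L[𝕜] H)) := by
    refine (IsSelfAdjoint.mul_star_self N).sub ?_
    rw [IsSelfAdjoint, star_smul, star_one, RCLike.star_def, RCLike.conj_ofReal]
  obtain ⟨w, e, k, hk⟩ := exists_eigenbasis hK.isCompactOperator hKs
  have hSe : ∀ i, N (star N (e i)) = ((k i + a ^ 2 : ℝ) : 𝕜) • e i := fun i => by
    have := hk i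
    rw [sub_apply, mul_apply_eq_comp, sub_eq_iff_eq_add] at this
    rw [this, RCLike.ofReal_add, add_smul]
    simp
  -- The singular values: `e` diagonalises `N N*` with eigenvalues `q i ^ 2`.
  set q : w → ℝ := fun i => ‖star N (e i)‖ with hq
  have hq2 : ∀ i, k i + a ^ 2 = q i ^ 2 := fun i => by
    have h1 := hadj (e i) (star N (e i))
    rw [hSe, inner_smul_right, inner_self_eq_norm_sq_to_K, inner_self_eq_norm_sq_to_K,
      e.orthonormal.1] at h1
    simp only [RCLike.ofReal_one, one_pow, mul_one] at h1
    exact_mod_cast h1.symm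
  simp only [hq2] at hSe
  have hsum : Summable fun i => (q i ^ 2 - a ^ 2) ^ 2 := by
    have := (isHilbertSchmidt_iff_summable e).mp hK
    simp only [hk, norm_smul, e.orthonormal.1, mul_one, RCLike.norm_ofReal, sq_abs] at this
    refine this.congr fun i => ?_
    rw [← hq2]; ring
  -- The images of `e i` under the unitary sought: the normalised `N* e i` where this is nonzero,
  -- and `u (e i)` on the kernel of `N*`. Either way `N (f i) = q i • e i`.
  let f : w → H := fun i =>
    if h : star N (e i) = 0 then (u ⟨e i, h⟩ : H) else ((q i)⁻¹ : 𝕜) • star N (e i)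
  have f0 : ∀ i (h : star N (e i) = 0), f i = u ⟨e i, h⟩ := fun i h => dif_pos h
  have f1 : ∀ i, star N (e i) ≠ 0 → f i = ((q i)⁻¹ : 𝕜) • star N (e i) := fun i h => dif_neg h
  have hq0 : ∀ i, star N (e i) ≠ 0 → (q i : 𝕜) ≠ 0 := fun i h => by simpa [hq] using h
  have hNf : ∀ i, N (f i) = (q i : 𝕜) • e i := fun i => by
    by_cases h : star N (e i) = 0
    · have h1 : N (u ⟨e i, h⟩ : H) = 0 := (u ⟨e i, h⟩).2
      rw [f0 i h, h1]
      simp [hq, h]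
    · rw [f1 i h, map_smul, hSe, smul_smul, RCLike.ofReal_pow, sq, inv_mul_cancel_left₀ (hq0 i h)]
  have hfN : ∀ i, star N (e i) = (q i : 𝕜) • f i := fun i => by
    by_cases h : star N (e i) = 0
    · simp [hq, h]
    · rw [f1 i h, smul_smul, mul_inv_cancel₀ (hq0 i h), one_smul]
  have hee := orthonormal_iff_ite.mp e.orthonormal
  have hf : Orthonormal 𝕜 f := by
    rw [orthonormal_iff_ite]
    intro i j
    rw [← hee i j]
    by_cases hj : star N (e j) = 0
    · by_cases hi : star N (e i) = 0
      · rw [f0 i hi, f0 j hj, ← Submodule.coe_inner, u.inner_map_map, Submodule.coe_inner]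
      · have h1 := hadj (e i) (f j)
        have h2 := hadj (e i) (star N (e j))
        rw [hNf, hfN i, inner_smul_left, inner_smul_right, RCLike.conj_ofReal] at h1
        have h3 : q j = 0 := by simp [hq, hj]
        have h4 : i ≠ j := by rintro rfl; exact hi hj
        rw [h3, RCLike.ofReal_zero, zero_mul] at h1
        rw [hee, if_neg h4]
        exact (mul_eq_zero.mp h1).resolve_left (hq0 i hi)
    · have h1 := hadj' (e j) (f i)
      rw [hNf, hfN j, inner_smul_left, inner_smul_right, RCLike.conj_ofReal] at h1
      by_cases hij : i = j
      · subst hij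
        exact mul_left_cancel₀ (hq0 i hj) h1
      · rw [hee, if_neg hij, mul_zero] at h1
        rw [hee, if_neg hij]
        exact (mul_eq_zero.mp h1).resolve_left (hq0 j hj)
  -- A vector orthogonal to all `f i` lies in `ker N`, hence is `u y` with `y ∈ ker N*`, and `y` is
  -- then orthogonal to every `e i`.
  have hperp : (Submodule.span 𝕜 (Set.range f))ᗮ = ⊥ := by
    rw [eq_bot_iff]
    intro x hx
    have hfx : ∀ i, inner 𝕜 (f i) x = 0 := fun i =>
      (Submodule.mem_orthogonal _ _).mp hx (f i) (Submodule.subset_span ⟨i, rfl⟩)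
    have hNx : N x = 0 := eq_zero_of_inner_hilbertBasis e fun i => by
      rw [← hadj, hfN, inner_smul_left, hfx, mul_zero]
    obtain ⟨y, hy⟩ := u.surjective ⟨x, hNx⟩
    have hy0 : (y : H) = 0 := eq_zero_of_inner_hilbertBasis e fun i => by
      by_cases h : star N (e i) = 0
      · have := hfx i
        rw [f0 i h, show x = ((u y : LinearMap.ker N.toLinearMap) : H) by rw [hy],
          ← Submodule.coe_inner, u.inner_map_map] at this
        exact this
      · have h1 := hadj' (y : H) (star N (e i))
        have h2 : star N (y : H) = 0 := y.2
        rw [hSe, h2, inner_zero_right, inner_smul_left, RCLike.conj_ofReal, RCLike.ofReal_pow]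
          at h1
        exact (mul_eq_zero.mp h1.symm).resolve_left (pow_ne_zero 2 (hq0 i h))
    have : y = 0 := Subtype.ext hy0
    rw [this, map_zero] at hy
    exact (congrArg Subtype.val hy).symm
  let F := HilbertBasis.mkOfOrthogonalEqBot hf hperp
  let V : H ≃ₗᵢ[𝕜] H := e.repr.trans F.repr.symm
  have hV : ∀ i, V (e i) = f i := fun i => by
    change F.repr.symm (e.repr (e i)) = f i
    rw [e.repr_self, F.repr_symm_single, HilbertBasis.coe_mkOfOrthogonalEqBot]
  have hVmem := mem_unitary_of_linearIsometryEquiv V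
  have hNV : ∀ i, (N * (V : H →L[𝕜] H)) (e i) = (q i : 𝕜) • e i := fun i => by
    rw [mul_apply_eq_comp, ← hNf, ← hV]; rfl
  obtain ⟨S, hS, hSe'⟩ := exists_diagonal e q (M := ‖star N‖) fun i => by
    have := (star N).le_opNorm (e i)
    rw [e.orthonormal.1, mul_one] at this
    rwa [abs_of_nonneg (norm_nonneg _)]
  have hSN : N * (V : H →L[𝕜] H) = S :=
    clm_ext_hilbertBasis e fun i => (hNV i).trans (hSe' i).symm
  refine ⟨V, hVmem, ?_, hSN ▸ hS, fun x => ?_⟩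
  · have h1 : HasScalarPart (N * (V : H →L[𝕜] H)) (a : 𝕜) := by
      rw [HasScalarPart, isHilbertSchmidt_iff_summable e]
      -- `|q i ^ 2 - a ^ 2| = (q i + a) |q i - a| ≥ a |q i - a|`.
      refine .of_nonneg_of_le (fun i => sq_nonneg _) (fun i => ?_) (hsum.mul_left ((a ^ 2)⁻¹))
      have h2 : (N * (V : H →L[𝕜] H) - (a : 𝕜) • (1 : H →L[𝕜] H)) (e i) =
          ((q i - a : ℝ) : 𝕜) • e i := by
        rw [sub_apply, hNV, RCLike.ofReal_sub, sub_smul]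
        simp
      rw [h2, norm_smul, e.orthonormal.1, mul_one, RCLike.norm_ofReal, sq_abs, le_inv_mul_iff₀
        (by positivity), sq_sub_sq, mul_pow, ← sub_nonneg, ← sub_mul]
      have : 0 ≤ q i := norm_nonneg _
      exact mul_nonneg (by nlinarith) (sq_nonneg _)
    -- `V - 1 = a⁻¹ ((N V - a) - (N - a) V)`.
    have h2 := IsHilbertSchmidt.smul (h1.sub (hasScalarPart_smul_one (a : 𝕜)) |> fun h => by
      simpa only [sub_self, hasScalarPart_zero_iff] using h) (a : 𝕜)⁻¹
    have h3 := (IsHilbertSchmidt.mul_right hN (V : H →L[𝕜] H)).smul (a : 𝕜)⁻¹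
    have ha' : (a : 𝕜) ≠ 0 := by exact_mod_cast ha.ne'
    have h4 := h2.sub h3
    unfold HasScalarPart
    convert h4 using 1
    rw [← smul_sub, sub_mul, sub_sub_sub_cancel_left, smul_mul_assoc, one_mul, ← smul_sub,
      inv_smul_smul₀ ha', one_smul]
  · have h1 := (e.hasSum_inner_mul_inner x (S x)).mapL RCLike.reCLM
    rw [hSN]
    refine h1.nonneg fun i => ?_
    rw [inner_eigenvector hS (hSe' i), mul_left_comm, ← inner_conj_symm x (e i), RCLike.conj_mul,
      RCLike.reCLM_apply, ← RCLike.ofReal_pow, ← RCLike.ofReal_mul, RCLike.ofReal_re]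
    exact mul_nonneg (norm_nonneg _) (sq_nonneg _)

/-! ### Existence of a minimiser. -/

/-- The Procrustes problem `min ‖(R A - c) - R B W‖` has a solution among the unitary operators `W`
for which `W - 1` is Hilbert–Schmidt. -/
theorem exists_unitary_minimizer {A B R : H →L[𝕜] H} {a b r : ℝ} (hb : 0 < b) (hr : 0 < r)
    (hA : IsSelfAdjoint A) (hA' : IsUnit A) (hAa : HasScalarPart A (a : 𝕜))
    (hB' : IsUnit B) (hBb : HasScalarPart B (b : 𝕜))
    (hR : IsSelfAdjoint R) (hR' : IsUnit R) (hRr : HasScalarPart R (r : 𝕜)) :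
    ∃ W ∈ unitary (H →L[𝕜] H), HasScalarPart W 1 ∧
      ∀ W' ∈ unitary (H →L[𝕜] H), HasScalarPart W' 1 →
        hsSq (R * (A - B * W) - ((r * (a - b) : ℝ) : 𝕜) • (1 : H →L[𝕜] H)) ≤
          hsSq (R * (A - B * W') - ((r * (a - b) : ℝ) : 𝕜) • (1 : H →L[𝕜] H)) := by
  set c : 𝕜 := ((r * (a - b) : ℝ) : 𝕜) with hc
  set C := R * A - c • (1 : H →L[𝕜] H) with hC
  set G := R * B with hG
  have hCs : HasScalarPart C ((r * b : ℝ) : 𝕜) := by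
    have := (hRr.mul hAa).sub (hasScalarPart_smul_one c)
    convert this using 1
    rw [hc]; push_cast; ring
  have hGs : HasScalarPart G ((r * b : ℝ) : 𝕜) := by
    simpa using hRr.mul hBb
  have hstarC : star C = A * R - c • (1 : H →L[𝕜] H) := by
    rw [hC, star_sub, star_mul, hA.star_eq, hR.star_eq, star_smul, star_one, hc, RCLike.star_def,
      RCLike.conj_ofReal]
  have hNs : HasScalarPart (star C * G) ((r * b * (r * b) : ℝ) : 𝕜) := by
    simpa using hCs.star.mul hGs
  obtain ⟨g, hg⟩ : IsUnit G := hR'.mul hB'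
  have hgs : IsUnit (star G) := by rw [← hg]; exact g.isUnit.star
  obtain ⟨g', hg'⟩ := hgs
  -- Both sides reduce to `C* A = A C`, that is `(A R - c) A = A (R A - c)`.
  have hrel : star C * G * (↑g⁻¹ * A) = A * ↑g'⁻¹ * star (star C * G) := by
    rw [star_mul, star_star, ← hg, mul_assoc, Units.mul_inv_cancel_left, hg, ← hg', mul_assoc,
      Units.inv_mul_cancel_left, hstarC, hC, sub_mul, mul_sub, mul_assoc]
    simp
  have hpos : 0 < r * b * (r * b) := by positivity
  obtain ⟨u⟩ := nonempty_ker_star_isometry hNs (by exact_mod_cast hpos.ne')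
    (g⁻¹.isUnit.mul hA') (hA'.mul g'⁻¹.isUnit) hrel
  obtain ⟨W, hW, hW1, hs, hp⟩ := exists_unitary_mul_nonneg hpos hNs u
  have hexp : ∀ W, R * (A - B * W) - c • (1 : H →L[𝕜] H) = C - G * W := fun W => by
    rw [hC, hG, mul_sub, mul_assoc]; abel
  refine ⟨W, hW, hW1, fun W' hW' hW1' => ?_⟩
  -- Every competitor is `W (1 + T)` with `T = W* W' - 1` Hilbert–Schmidt, so the criterion applies
  -- to `C` and `G W`.
  have hWW : W * (1 + (star W * W' - 1)) = W' := by
    rw [add_sub_cancel, ← mul_assoc, Unitary.mul_star_self_of_mem hW, one_mul]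
  rw [mul_assoc] at hs
  simp_rw [mul_assoc] at hp
  have key := hsSq_sub_le_of_nonneg (C := C) (G := G * W) (T := star W * W' - 1) ?_ hs hp ?_ ?_
  · rwa [hexp, hexp, ← hWW, ← mul_assoc G]
  · have := hCs.sub (hGs.mul hW1)
    rwa [mul_one, sub_self, hasScalarPart_zero_iff] at this
  · have := hW1.star.mul hW1'
    simpa [HasScalarPart] using this
  · rw [add_sub_cancel]
    exact mul_mem (Unitary.star_mem hW) hW'

/-! ### The two Mahalanobis norms and their comparison. -/

theorem hsSq_smul (c : 𝕜) (A : H →L[𝕜] H) : hsSq (c • A) = ‖c‖ₑ ^ 2 * hsSq A := by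
  simp [hsSq, enorm_smul, mul_pow, ENNReal.tsum_mul_left]

theorem extendedHSNorm_eq (hH : ¬ FiniteDimensional 𝕜 H) {Z : H →L[𝕜] H} {c : 𝕜}
    (h : HasScalarPart Z c) :
    extendedHSNorm Z =
      (hsSq (Z - c • (1 : H →L[𝕜] H)) + ENNReal.ofReal (‖c‖ ^ 2)) ^ (1 / 2 : ℝ) := by
  simp only [extendedHSNorm, trace_star_mul_self]
  refine le_antisymm (iInf_le _ c) (le_iInf fun d => ?_)
  by_cases hd : HasScalarPart Z d
  · rw [h.unique hH hd]
  · rw [HasScalarPart, isHilbertSchmidt_iff, not_lt, top_le_iff] at hd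
    rw [hd, top_add, ENNReal.top_rpow_of_pos (by norm_num)]
    exact le_top

theorem IsUnitizedHSPosDef.mahalanobisNorm_eq (hH : ¬ FiniteDimensional 𝕜 H) {M : H →L[𝕜] H}
    {ρ : ℝ} (hM : IsUnitizedHSPosDef M ρ) (Z : H →L[𝕜] H) :
    mahalanobisNorm M ρ Z = hsSq (power (shift M ρ) (-1 / 2) * Z) ^ (1 / 2 : ℝ) := by
  rw [mahalanobisNorm, hM.inverse_shift hH, ← trace_star_mul_self, star_mul,
    (hM.power_spec hH _).1.star_eq]
  simp only [mul_assoc]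

theorem IsUnitizedHSPosDef.scalar_pos (hH : ¬ FiniteDimensional 𝕜 H) {X : H →L[𝕜] H}
    {δ : ℝ} (hX : IsUnitizedHSPosDef X δ) : 0 < δ := by
  obtain ⟨_, _, _, m, _, hm, hδ, _⟩ := hX.exists_eigenbasis hH
  exact hm.trans_le hδ.1

theorem IsHilbertSchmidt.of_isUnit_mul {R Z : H →L[𝕜] H} (hR : IsUnit R)
    (h : IsHilbertSchmidt (R * Z)) : IsHilbertSchmidt Z := by
  obtain ⟨R, rfl⟩ := hR
  simpa using h.mul_left ↑R⁻¹

/-- If `A - B W` is Hilbert–Schmidt for a unitary operator `W`, then the scalar parts of `A` and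
`B` agree, and `W - 1` is Hilbert–Schmidt. -/
theorem eq_and_hasScalarPart_of_isHilbertSchmidt_sub (hH : ¬ FiniteDimensional 𝕜 H)
    {A B W : H →L[𝕜] H} {a b : ℝ} (ha : 0 < a) (hb : 0 < b) (hA : HasScalarPart A (a : 𝕜))
    (hB : HasScalarPart B (b : 𝕜)) (hB' : IsUnit B) (hW : W ∈ unitary (H →L[𝕜] H))
    (h : IsHilbertSchmidt (A - B * W)) : a = b ∧ HasScalarPart W 1 := by
  obtain ⟨B, rfl⟩ := hB'
  have hBi := hB.inverse (by exact_mod_cast hb.ne') B.inv_mul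
  -- `W = B⁻¹ (A - (A - B W))` has scalar part `b⁻¹ a`; comparing scalar parts in `W* W = 1` shows
  -- that its square is `1`, and positivity gives `b⁻¹ a = 1`.
  have h1 := hBi.mul (hA.sub (hasScalarPart_zero_iff.mpr h))
  rw [sub_sub_cancel, Units.inv_mul_cancel_left, sub_zero, ← RCLike.ofReal_inv,
    ← RCLike.ofReal_mul] at h1
  have h2 := h1.star.mul h1
  rw [Unitary.star_mul_self_of_mem hW, RCLike.conj_ofReal, ← RCLike.ofReal_mul] at h2
  have h3 : b⁻¹ * a * (b⁻¹ * a) = 1 := by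
    exact_mod_cast h2.unique hH hasScalarPart_one
  have h4 : b⁻¹ * a = 1 := by
    have : 0 < b⁻¹ * a := by positivity
    nlinarith
  rw [h4, RCLike.ofReal_one] at h1
  exact ⟨by rw [inv_mul_eq_one₀ hb.ne'] at h4; exact h4.symm, h1⟩

theorem isLeast_image_iInf {β : Type*} (f : β → ℝ≥0∞) (s : Set β) {x : β} (hx : x ∈ s)
    (h : ∀ y ∈ s, f x ≤ f y) : IsLeast (f '' s) (⨅ y ∈ s, f y) ∧ ⨅ y ∈ s, f y = f x := by
  have : ⨅ y ∈ s, f y = f x := le_antisymm (iInf₂_le x hx) (le_iInf₂ h)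
  exact ⟨this ▸ ⟨⟨x, hx, rfl⟩, by rintro _ ⟨y, hy, rfl⟩; exact h y hy⟩, this⟩

theorem hasScalarPart_one_add_iff {U : H →L[𝕜] H} :
    HasScalarPart (1 + U) 1 ↔ IsHilbertSchmidt U := by
  simp [HasScalarPart]

/-! ### Application to the Procrustes residual. -/

section residual

variable {X Y M : H →L[𝕜] H} {α δ γ ρ : ℝ}

/-- The scalar part of the weighted residual. -/
theorem hasScalarPart_power_mul_residual (hH : ¬ FiniteDimensional 𝕜 H)
    (hX : IsUnitizedHSPosDef X δ) (hY : IsUnitizedHSPosDef Y γ) (hM : IsUnitizedHSPosDef M ρ)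
    {U : H →L[𝕜] H} (hU : IsHilbertSchmidt U) :
    HasScalarPart (power (shift M ρ) (-1 / 2) * residual α X δ Y γ U)
      (((α⁻¹ : ℝ) : 𝕜) * ((ρ ^ (-1 / 2 : ℝ) * (δ ^ α - γ ^ α) : ℝ) : 𝕜)) := by
  have h := (hM.power_spec hH (-1 / 2)).2.2.mul (((hX.power_spec hH α).2.2.sub
    ((hY.power_spec hH α).2.2.mul (hasScalarPart_one_add_iff.mpr hU))).smul ((α⁻¹ : ℝ) : 𝕜))
  rw [residual]
  convert h using 1
  rw [RCLike.ofReal_mul, RCLike.ofReal_sub]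
  ring

theorem unitizedMahalanobisNorm_residual (hH : ¬ FiniteDimensional 𝕜 H)
    (hX : IsUnitizedHSPosDef X δ) (hY : IsUnitizedHSPosDef Y γ) (hM : IsUnitizedHSPosDef M ρ)
    {U : H →L[𝕜] H} (hU : IsHilbertSchmidt U) :
    unitizedMahalanobisNorm M ρ (residual α X δ Y γ U) =
      (‖((α⁻¹ : ℝ) : 𝕜)‖ₑ ^ 2 * hsSq (power (shift M ρ) (-1 / 2) *
        (power (shift X δ) α - power (shift Y γ) α * (1 + U)) -
          ((ρ ^ (-1 / 2 : ℝ) * (δ ^ α - γ ^ α) : ℝ) : 𝕜) • (1 : H →L[𝕜] H)) +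
        ENNReal.ofReal (‖((α⁻¹ : ℝ) : 𝕜) * ((ρ ^ (-1 / 2 : ℝ) * (δ ^ α - γ ^ α) : ℝ) : 𝕜)‖ ^ 2))
        ^ (1 / 2 : ℝ) := by
  rw [unitizedMahalanobisNorm,
    extendedHSNorm_eq hH (hasScalarPart_power_mul_residual hH hX hY hM hU), ← hsSq_smul, smul_sub,
    smul_smul, residual, mul_smul_comm]

theorem unitizedMahalanobisNorm_residual_lt_top (hH : ¬ FiniteDimensional 𝕜 H)
    (hX : IsUnitizedHSPosDef X δ) (hY : IsUnitizedHSPosDef Y γ) (hM : IsUnitizedHSPosDef M ρ)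
    {U : H →L[𝕜] H} (hU : IsHilbertSchmidt U) :
    unitizedMahalanobisNorm M ρ (residual α X δ Y γ U) < ∞ := by
  have h := hasScalarPart_power_mul_residual (α := α) hH hX hY hM hU
  rw [unitizedMahalanobisNorm, extendedHSNorm_eq hH h]
  exact ENNReal.rpow_lt_top_of_nonneg (by norm_num)
    (ENNReal.add_ne_top.mpr ⟨(isHilbertSchmidt_iff.mp h).ne, ENNReal.ofReal_ne_top⟩)

theorem exists_unitizedMahalanobisNorm_minimizer (hH : ¬ FiniteDimensional 𝕜 H)
    (hX : IsUnitizedHSPosDef X δ) (hY : IsUnitizedHSPosDef Y γ) (hM : IsUnitizedHSPosDef M ρ) :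
    ∃ U ∈ unitaryHSShifts 𝕜 H, ∀ U' ∈ unitaryHSShifts 𝕜 H,
      unitizedMahalanobisNorm M ρ (residual α X δ Y γ U) ≤
        unitizedMahalanobisNorm M ρ (residual α X δ Y γ U') := by
  obtain ⟨hA, hA', hAa⟩ := hX.power_spec hH α
  obtain ⟨-, hB', hBb⟩ := hY.power_spec hH α
  obtain ⟨hR, hR', hRr⟩ := hM.power_spec hH (-1 / 2)
  obtain ⟨W, hW, hW1, hmin⟩ := exists_unitary_minimizer
    (Real.rpow_pos_of_pos (hY.scalar_pos hH) α)
    (Real.rpow_pos_of_pos (hM.scalar_pos hH) (-1 / 2)) hA hA' hAa hB' hBb hR hR' hRr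
  have hU : IsHilbertSchmidt (W - 1) := by
    rwa [← hasScalarPart_one_add_iff, add_sub_cancel]
  refine ⟨W - 1, ⟨?_, hU⟩, fun U' hU' => ?_⟩
  · rwa [add_sub_cancel]
  rw [unitizedMahalanobisNorm_residual hH hX hY hM hU,
    unitizedMahalanobisNorm_residual hH hX hY hM hU'.2, add_sub_cancel]
  -- The factor `‖α⁻¹‖²` and the scalar summand do not depend on the unitary, so only the
  -- Hilbert–Schmidt parts are compared.
  gcongr
  exact hmin _ hU'.1 (hasScalarPart_one_add_iff.mpr hU'.2)

theorem eq_and_isHilbertSchmidt_of_mahalanobisNorm_ne_top (hH : ¬ FiniteDimensional 𝕜 H)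
    (hα : 0 < α) (hX : IsUnitizedHSPosDef X δ) (hY : IsUnitizedHSPosDef Y γ)
    (hM : IsUnitizedHSPosDef M ρ) {U : H →L[𝕜] H} (hU : U ∈ unitaryShifts 𝕜 H)
    (h : mahalanobisNorm M ρ (residual α X δ Y γ U) ≠ ∞) : δ = γ ∧ IsHilbertSchmidt U := by
  rw [hM.mahalanobisNorm_eq hH, Ne, ENNReal.rpow_eq_top_iff_of_pos (by norm_num), ← Ne,
    ← lt_top_iff_ne_top, ← isHilbertSchmidt_iff] at h
  have h1 := (h.of_isUnit_mul (hM.power_spec hH _).2.1).smul (α : 𝕜)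
  rw [residual, smul_smul, ← RCLike.ofReal_mul, mul_inv_cancel₀ hα.ne', RCLike.ofReal_one,
    one_smul] at h1
  have hδ := hX.scalar_pos hH
  have hγ := hY.scalar_pos hH
  have h2 := eq_and_hasScalarPart_of_isHilbertSchmidt_sub hH (Real.rpow_pos_of_pos hδ α)
    (Real.rpow_pos_of_pos hγ α) (hX.power_spec hH α).2.2 (hY.power_spec hH α).2.2
    (hY.power_spec hH α).2.1 hU h1
  exact ⟨(Real.rpow_left_inj hδ.le hγ.le hα.ne').mp h2.1, hasScalarPart_one_add_iff.mp h2.2⟩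

/-- With equal scalars the weighted residual has scalar part `0`, so the extended norm is the plain
Hilbert–Schmidt norm. -/
theorem mahalanobisNorm_residual_eq_unitized (hH : ¬ FiniteDimensional 𝕜 H)
    (hX : IsUnitizedHSPosDef X δ) (hY : IsUnitizedHSPosDef Y δ) (hM : IsUnitizedHSPosDef M ρ)
    {U : H →L[𝕜] H} (hU : IsHilbertSchmidt U) :
    mahalanobisNorm M ρ (residual α X δ Y δ U) =
      unitizedMahalanobisNorm M ρ (residual α X δ Y δ U) := by
  have h := hasScalarPart_power_mul_residual (α := α) hH hX hY hM hU
  rw [sub_self, mul_zero, RCLike.ofReal_zero, mul_zero] at h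
  rw [hM.mahalanobisNorm_eq hH, unitizedMahalanobisNorm, extendedHSNorm_eq hH h]
  simp

/-- A minimizer for the unitized norm also minimizes the norm defined by the ordinary trace. -/
theorem mahalanobisNorm_le_of_unitized_minimizer (hH : ¬ FiniteDimensional 𝕜 H) (hα : 0 < α)
    (hX : IsUnitizedHSPosDef X δ) (hY : IsUnitizedHSPosDef Y γ) (hM : IsUnitizedHSPosDef M ρ)
    {U U' : H →L[𝕜] H} (hU : IsHilbertSchmidt U) (hU' : U' ∈ unitaryShifts 𝕜 H)
    (hmin : ∀ U' ∈ unitaryHSShifts 𝕜 H, unitizedMahalanobisNorm M ρ (residual α X δ Y γ U) ≤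
      unitizedMahalanobisNorm M ρ (residual α X δ Y γ U')) :
    mahalanobisNorm M ρ (residual α X δ Y γ U) ≤ mahalanobisNorm M ρ (residual α X δ Y γ U') := by
  by_cases htop : mahalanobisNorm M ρ (residual α X δ Y γ U') = ∞
  · rw [htop]
    exact le_top
  · obtain ⟨rfl, hHS⟩ :=
      eq_and_isHilbertSchmidt_of_mahalanobisNorm_ne_top hH hα hX hY hM hU' htop
    rw [mahalanobisNorm_residual_eq_unitized hH hX hY hM hU,
      mahalanobisNorm_residual_eq_unitized hH hX hY hM hHS]
    exact hmin U' ⟨hU', hHS⟩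

end residual

end

end AlphaProcrustes

theorem proposition3p1 {𝕜 : Type*} [RCLike 𝕜] {H : Type*} [NormedAddCommGroup H]
    [InnerProductSpace 𝕜 H] [CompleteSpace H] [TopologicalSpace.SeparableSpace H]
    (hH : ¬ FiniteDimensional 𝕜 H)
    (α δ γ ρ : ℝ) (hα : 0 < α) (hρ : 0 < ρ)
    (X Y M : H →L[𝕜] H)
    (hX : AlphaProcrustes.IsUnitizedHSPosDef X δ)
    (hY : AlphaProcrustes.IsUnitizedHSPosDef Y γ)
    (hM : AlphaProcrustes.IsUnitizedHSPosDef M ρ) :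
    IsLeast
      ((fun U => AlphaProcrustes.mahalanobisNorm M ρ (AlphaProcrustes.residual α X δ Y γ U)) ''
        AlphaProcrustes.unitaryShifts 𝕜 H)
      (AlphaProcrustes.procrustesDist M ρ α X δ Y γ) ∧
    IsLeast
      ((fun U =>
          AlphaProcrustes.unitizedMahalanobisNorm M ρ (AlphaProcrustes.residual α X δ Y γ U)) ''
        AlphaProcrustes.unitaryHSShifts 𝕜 H)
      (AlphaProcrustes.unitizedProcrustesDist M ρ α X δ Y γ) ∧
    AlphaProcrustes.unitizedProcrustesDist M ρ α X δ Y γ < ⊤ ∧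
    (δ = γ →
      AlphaProcrustes.procrustesDist M ρ α X δ Y γ =
        AlphaProcrustes.unitizedProcrustesDist M ρ α X δ Y γ) := by
  obtain ⟨U, hU, hmin⟩ :=
    AlphaProcrustes.exists_unitizedMahalanobisNorm_minimizer (α := α) hH hX hY hM
  have hext := AlphaProcrustes.isLeast_image_iInf _ _ hU hmin
  -- The same `U` is minimal for the ordinary trace, over the larger set of all unitaries.
  have hord := AlphaProcrustes.isLeast_image_iInf
    (fun U => AlphaProcrustes.mahalanobisNorm M ρ (AlphaProcrustes.residual α X δ Y γ U))
    (AlphaProcrustes.unitaryShifts 𝕜 H) hU.1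
    fun U' hU' => AlphaProcrustes.mahalanobisNorm_le_of_unitized_minimizer hH hα hX hY hM hU.2 hU'
      hmin
  refine ⟨hord.1, hext.1, ?_, ?_⟩
  · exact hext.2.trans_lt
      (AlphaProcrustes.unitizedMahalanobisNorm_residual_lt_top hH hX hY hM hU.2)
  · rintro rfl
    exact hord.2.trans ((AlphaProcrustes.mahalanobisNorm_residual_eq_unitized hH hX hY hM
      hU.2).trans hext.2.symm)
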